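/- Let $G$ be a finite simple connected graph on $n\geq 3$ vertices. A connected set of $G$ is a nonempty set of vertices that induces a connected subgraph; let $N(G)$ be the number of connected sets of $G$ and, for a vertex $v$, let $N(G;v)$ be the number of connected sets containing $v$. A diametral path is a shortest path between two vertices at distance $\operatorname{diam}(G)$. Then there is a vertex $v$ of $G$, which is an endpoint of a diametral path, such that $G-v$ is connected and \[N(G;v)\geq\frac{2N(G)}{n+1},\] where, for this $v$, equality holds if and only if $G$ is a path. Moreover, for every diametral path of $G$, at least one of its two endpoints is such a vertex $v$. -/

import Mathlib

namespace SimpleGraph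

variable {V : Type*} (G : SimpleGraph V)

/-- A connected set: a nonempty vertex set whose induced subgraph is connected
(`SimpleGraph.Connected` includes nonemptiness). -/
def IsConnectedSet (S : Finset V) : Prop :=
  (G.induce (S : Set V)).Connected

open Classical in
/-- The family of all connected sets of `G`. -/
noncomputable def connectedSets [Fintype V] : Finset (Finset V) :=
  Finset.univ.filter fun S => G.IsConnectedSet S

/-- `N(G)`, the number of connected sets of `G`. -/
noncomputable def numConnectedSets [Fintype V] : ℕ :=
  G.connectedSets.card

open Classical in
/-- `N(G; v)`, the number of connected sets of `G` that contain `v`. -/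
noncomputable def numConnectedSetsAt [Fintype V] (v : V) : ℕ :=
  (G.connectedSets.filter fun S => v ∈ S).card

/-- `G` is a path: it is isomorphic to the path graph on its number of vertices. -/
def IsPathGraph [Fintype V] : Prop :=
  Nonempty (G ≃g pathGraph (Fintype.card V))

variable {G} in
/-- A diametral path: a shortest path between two vertices at distance `diam G`. -/
def Walk.IsDiametral {u w : V} (P : G.Walk u w) : Prop :=
  P.IsPath ∧ P.length = G.dist u w ∧ G.dist u w = G.diam

end SimpleGraph

/-! Fix a diametral path `P = v 0, …, v D` and write `n = D + 1 + m`. For graphs other than paths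
(`m ≥ 1`) both ends are treated together: it is shown that `4 N(G) < (n + 1) (N(G; v 0) + N(G; v
D))`, so one end exceeds `2 N(G) / (n + 1)`.

All connected sets are charged to connected sets `T` containing both ends. A set meeting `P` becomes
such a `T` once `P` is filled in from each end up to its first vertex in the set; it is recovered
from `T` and the numbers `(a, b)` of vertices trimmed off (`exists_trim_eq`, `trim_injective`). The
admissible pairs form a lower set whose axes, of lengths `a + 1` and `b + 1`, count sets containing
`v D` and `v 0` respectively. A set avoiding `P` is joined to `P` by a shortest path and recovered
from `T ⊇ P` and its distance to `P` (`exists_join_of_disjoint`).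

It remains to compare the contributions of each `T`. Distance levels from `v 0` bound `a + b`
(`add_le_of_segment_ssubset`), and AM-GM gives the inequality for every `T` except possibly the
whole vertex set. Its deficit is smaller than the surplus `2 (D + 1) m` of `T = P`
(`four_mul_add_le`).

If `m = 0`, then `G` is a path, its connected sets are the segments, and equality is a count. -/

namespace SimpleGraph

/-! ### Connected sets, distance levels and diametral sequences -/

section ConnectedSets

open scoped Classical

variable {V : Type*} {G : SimpleGraph V}

lemma IsConnectedSet.union {S T : Finset V} (hS : G.IsConnectedSet S) (hT : G.IsConnectedSet T)
    (h : ∃ x, x ∈ S ∧ x ∈ T) : G.IsConnectedSet (S ∪ T) := by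
  unfold IsConnectedSet at *
  rw [Finset.coe_union]
  exact induce_union_connected hS.preconnected hT.preconnected h

lemma isConnectedSet_singleton (x : V) : G.IsConnectedSet {x} := by
  unfold IsConnectedSet
  rw [Finset.coe_singleton, induce_singleton_eq_top]
  exact connected_top

lemma IsConnectedSet.insert_of_adj {S : Finset V} (hS : G.IsConnectedSet S) {x y : V}
    (hy : y ∈ S) (hxy : G.Adj x y) : G.IsConnectedSet (insert x S) := by
  have h := connected_induce_union (s := {x}) (t := (S : Set V))
    (by simp) hS.preconnected rfl hy hxy
  unfold IsConnectedSet
  rwa [Finset.coe_insert, Set.insert_eq]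

lemma IsConnectedSet.nonempty {S : Finset V} (hS : G.IsConnectedSet S) : S.Nonempty := by
  obtain ⟨x, hx⟩ := Connected.nonempty hS
  exact ⟨x, hx⟩

/-- A function that rises by at most one per step cannot jump over `t` on its way up. -/
lemma Walk.exists_eq_of_le {W : Type*} {H : SimpleGraph W} {f : W → ℕ}
    (hf : ∀ x y, H.Adj x y → f y ≤ f x + 1) {x y : W} (p : H.Walk x y) {t : ℕ}
    (hx : f x ≤ t) (hy : t ≤ f y) : ∃ z, f z = t := by
  induction p with
  | nil => exact ⟨_, le_antisymm hx hy⟩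
  | @cons a b c hab p ih =>
    by_cases h : f a = t
    · exact ⟨_, h⟩
    · exact ih (by have := hf _ _ hab; omega) hy

/-- A discrete intermediate value property on connected sets. -/
lemma IsConnectedSet.exists_eq {S : Finset V} (hS : G.IsConnectedSet S) {f : V → ℕ}
    (hf : ∀ x y, G.Adj x y → f y ≤ f x + 1) {x y : V} (hxS : x ∈ S) (hyS : y ∈ S) {t : ℕ}
    (hx : f x ≤ t) (hy : t ≤ f y) : ∃ z ∈ S, f z = t := by
  obtain ⟨p⟩ := hS.preconnected ⟨x, hxS⟩ ⟨y, hyS⟩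
  obtain ⟨z, hz⟩ := p.exists_eq_of_le (f := fun z => f z.1) (fun a b h => hf _ _ h) hx hy
  exact ⟨z.1, z.2, hz⟩

lemma dist_le_dist_add_one_of_adj (hG : G.Connected) (u : V) {x y : V} (h : G.Adj x y) :
    G.dist u y ≤ G.dist u x + 1 := by
  have := hG.dist_triangle (u := u) (v := x) (w := y)
  rwa [dist_eq_one_iff_adj.mpr h] at this

/-- Deleting a vertex `u` at maximal distance from some vertex `w` keeps a connected graph
connected. -/
lemma Connected.induce_compl_singleton_of_dist_le (hG : G.Connected) {u w : V} (huw : w ≠ u)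
    (h : ∀ x, G.dist w x ≤ G.dist w u) : (G.induce ({u}ᶜ : Set V)).Connected := by
  refine induce_connected_of_patches w (by simpa using huw) ?_
  intro x hx
  obtain ⟨p, hp⟩ := hG.exists_walk_length_eq_dist w x
  refine ⟨{y | y ∈ p.support}, ?_, p.start_mem_support, p.end_mem_support,
    p.connected_induce_support _ _⟩
  intro y hy hyu
  obtain rfl : y = u := hyu
  have h1 := p.take_spec hy
  have h2 := congrArg Walk.length h1
  -- A shortest walk from `w` to `x` through `u` has length at least `dist w u ≥ dist w x`, so
  -- nothing is left after `u` and `x = u`.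
  rw [Walk.length_append] at h2
  have h3 := dist_le (p.takeUntil y hy)
  have h4 : (p.dropUntil y hy).length = 0 := by have := h x; omega
  exact hx (Walk.eq_of_length_eq_zero h4).symm

/-- A sequence `v 0, …, v D` forming a diametral path of `G`. -/
structure IsDiametralSeq (G : SimpleGraph V) (D : ℕ) (v : ℕ → V) : Prop where
  connected : G.Connected
  adj : ∀ i < D, G.Adj (v i) (v (i + 1))
  dist_eq : ∀ i ≤ D, G.dist (v 0) (v i) = i
  dist_le : ∀ x y, G.dist x y ≤ D

/-- Splitting at the `i`-th vertex gives pieces of lengths `i` and `P.length - i`; by the triangle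
inequality neither can be shortened. -/
lemma Walk.IsDiametral.isDiametralSeq [Fintype V] (hG : G.Connected) {u w : V} {P : G.Walk u w}
    (hP : P.IsDiametral) : IsDiametralSeq G P.length P.getVert where
  connected := hG
  adj i hi := P.adj_getVert_succ hi
  dist_eq i hi := by
    have h1 := SimpleGraph.dist_le (P.take i)
    have h2 := SimpleGraph.dist_le (P.drop i)
    have h3 := hG.dist_triangle (u := u) (v := P.getVert i) (w := w)
    have h4 := hP.2.1
    rw [Walk.take_length] at h1
    rw [Walk.drop_length] at h2
    rw [P.getVert_zero]
    omega
  dist_le x y := by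
    have := hG.nonempty
    rw [hP.2.1, hP.2.2]
    exact dist_le_diam (connected_iff_ediam_ne_top.mp hG)

lemma Walk.IsDiametral.reverse {u w : V} {P : G.Walk u w} (hP : P.IsDiametral) :
    P.reverse.IsDiametral :=
  ⟨hP.1.reverse, by rw [Walk.length_reverse, hP.2.1, SimpleGraph.dist_comm],
    by rw [SimpleGraph.dist_comm, hP.2.2]⟩

/-- The vertices `v k` with `i ≤ k < j`. -/
noncomputable def segment (v : ℕ → V) (i j : ℕ) : Finset V := (Finset.Ico i j).image v

lemma mem_segment {v : ℕ → V} {i j : ℕ} {x : V} :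
    x ∈ segment v i j ↔ ∃ k, i ≤ k ∧ k < j ∧ v k = x := by
  simp [segment, and_assoc]

namespace IsDiametralSeq

variable {D : ℕ} {v : ℕ → V}

lemma inj (h : IsDiametralSeq G D v) {i j : ℕ} (hi : i ≤ D) (hj : j ≤ D) (hij : v i = v j) :
    i = j := by
  rw [← h.dist_eq i hi, ← h.dist_eq j hj, hij]

lemma mem_segment_iff (h : IsDiametralSeq G D v) {i j k : ℕ} (hk : k ≤ D) (hj : j ≤ D + 1) :
    v k ∈ segment v i j ↔ i ≤ k ∧ k < j := by
  rw [mem_segment]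
  constructor
  · rintro ⟨l, h1, h2, h3⟩
    obtain rfl := h.inj (by omega) hk h3
    exact ⟨h1, h2⟩
  · exact fun ⟨h1, h2⟩ => ⟨k, h1, h2, rfl⟩

lemma isConnectedSet_segment (h : IsDiametralSeq G D v) {i j : ℕ} (hij : i < j) (hj : j ≤ D + 1) :
    G.IsConnectedSet (segment v i j) := by
  induction j, hij using Nat.le_induction with
  | base =>
    have : segment v i (i + 1) = {v i} := by simp [segment]
    rw [this]
    exact isConnectedSet_singleton _
  | succ j hij ih =>
    have : segment v i (j + 1) = insert (v j) (segment v i j) := by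
      ext x
      simp only [mem_segment, Finset.mem_insert]
      constructor
      · rintro ⟨k, h1, h2, rfl⟩
        by_cases hk : k = j
        · subst hk; exact Or.inl rfl
        · exact Or.inr ⟨k, h1, by omega, rfl⟩
      · rintro (rfl | ⟨k, h1, h2, rfl⟩)
        · exact ⟨j, by omega, by omega, rfl⟩
        · exact ⟨k, h1, by omega, rfl⟩
    rw [this]
    obtain ⟨l, rfl⟩ : ∃ l, j = l + 1 := ⟨j - 1, by omega⟩
    refine (ih (by omega)).insert_of_adj (y := v l) ?_ (h.adj l (by omega)).symm
    exact mem_segment.mpr ⟨l, by omega, by omega, rfl⟩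

lemma card_segment (h : IsDiametralSeq G D v) : (segment v 0 (D + 1)).card = D + 1 := by
  rw [segment, Finset.card_image_of_injOn, Nat.card_Ico, Nat.sub_zero]
  intro i hi j hj hij
  simp only [Finset.coe_Ico, Set.mem_Ico] at hi hj
  exact h.inj (by omega) (by omega) hij

lemma dist_le_dist_add_one (h : IsDiametralSeq G D v) (x y : V) (hxy : G.Adj x y) :
    G.dist (v 0) y ≤ G.dist (v 0) x + 1 :=
  dist_le_dist_add_one_of_adj h.connected _ hxy

end IsDiametralSeq

end ConnectedSets

end SimpleGraph

namespace SimpleGraph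

/-! ### Trimming the ends of the path off a connected set -/

section Trimming

open scoped Classical

/-- A lower set of pairs below the line `a + b = D` is bounded in terms of its sections with the
coordinate axes. -/
lemma lowerSet_bounds {R : Finset (ℕ × ℕ)} {D : ℕ}
    (hlow : ∀ a b a' b', (a, b) ∈ R → a' ≤ a → b' ≤ b → (a', b') ∈ R)
    (hD : ∀ a b, (a, b) ∈ R → a + b ≤ D) (h0 : (0, 0) ∈ R) :
    ∃ a b, (a, 0) ∈ R ∧ (0, b) ∈ R ∧ (R.filter fun x => x.2 = 0).card = a + 1 ∧
      (R.filter fun x => x.1 = 0).card = b + 1 ∧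
      R.card ≤ (a + 1) * (b + 1) ∧ R.card + (a + b) ≤ (a + 1) * (b + 1) + D := by
  obtain ⟨a, ha, hamax⟩ : ∃ a, (a, 0) ∈ R ∧ ∀ i, (i, 0) ∈ R → i ≤ a := by
    have hne : ((R.filter fun x => x.2 = 0).image Prod.fst).Nonempty :=
      ⟨0, Finset.mem_image.mpr ⟨(0, 0), by simpa using h0, rfl⟩⟩
    refine ⟨Finset.max' _ hne, ?_, fun i hi => Finset.le_max' _ _ (by simpa using hi)⟩
    simpa using Finset.max'_mem _ hne
  obtain ⟨b, hb, hbmax⟩ : ∃ b, (0, b) ∈ R ∧ ∀ i, (0, i) ∈ R → i ≤ b := by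
    have hne : ((R.filter fun x => x.1 = 0).image Prod.snd).Nonempty :=
      ⟨0, Finset.mem_image.mpr ⟨(0, 0), by simpa using h0, rfl⟩⟩
    refine ⟨Finset.max' _ hne, ?_, fun i hi => Finset.le_max' _ _ (by simpa using hi)⟩
    simpa using Finset.max'_mem _ hne
  have hbox : ∀ x ∈ R, x.1 ≤ a ∧ x.2 ≤ b := fun x hx =>
    ⟨hamax _ (hlow _ _ _ _ hx le_rfl (Nat.zero_le _)),
      hbmax _ (hlow _ _ _ _ hx (Nat.zero_le _) le_rfl)⟩
  refine ⟨a, b, ha, hb, ?_, ?_, ?_, ?_⟩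
  · have : (R.filter fun x => x.2 = 0) = (Finset.range (a + 1)).image fun i => (i, 0) := by
      ext ⟨i, j⟩
      simp only [Finset.mem_filter, Finset.mem_image, Finset.mem_range, Prod.mk.injEq]
      constructor
      · rintro ⟨h, rfl⟩
        exact ⟨i, by have := hamax i h; omega, rfl, rfl⟩
      · rintro ⟨k, hk, rfl, rfl⟩
        exact ⟨hlow _ _ _ _ ha (by omega) le_rfl, rfl⟩
    rw [this, Finset.card_image_of_injective _ (fun i j h => (Prod.mk.inj h).1), Finset.card_range]
  · have : (R.filter fun x => x.1 = 0) = (Finset.range (b + 1)).image fun i => (0, i) := by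
      ext ⟨i, j⟩
      simp only [Finset.mem_filter, Finset.mem_image, Finset.mem_range, Prod.mk.injEq]
      constructor
      · rintro ⟨h, rfl⟩
        exact ⟨j, by have := hbmax j h; omega, rfl, rfl⟩
      · rintro ⟨k, hk, rfl, rfl⟩
        exact ⟨hlow _ _ _ _ hb le_rfl (by omega), rfl⟩
    rw [this, Finset.card_image_of_injective _ (fun i j h => (Prod.mk.inj h).2), Finset.card_range]
  · have : R ⊆ Finset.range (a + 1) ×ˢ Finset.range (b + 1) := fun x hx => by
      have := hbox x hx
      simp only [Finset.mem_product, Finset.mem_range]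
      omega
    simpa using Finset.card_le_card this
  -- Only the last column needs cutting at the line `a + b = D`; this saves `a + b - D` points of
  -- the box.
  · have : R ⊆ Finset.range a ×ˢ Finset.range (b + 1) ∪ {a} ×ˢ Finset.range (D + 1 - a) := by
      rintro ⟨i, j⟩ hx
      have h1 := hbox _ hx
      have h2 := hD _ _ hx
      simp only [Finset.mem_union, Finset.mem_product, Finset.mem_range, Finset.mem_singleton]
      simp only at h1
      omega
    have h := (Finset.card_le_card this).trans (Finset.card_union_le _ _)
    have haD := hD _ _ ha
    simp only [Finset.card_product, Finset.card_range, Finset.card_singleton, one_mul] at h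
    have : (a + 1) * (b + 1) = a * (b + 1) + b + 1 := by ring
    omega

variable {V : Type*} {G : SimpleGraph V} {D : ℕ} {v : ℕ → V}

/-- Remove the first `a` and the last `b` vertices of the sequence `v 0, …, v D` from `T`. -/
noncomputable def trim (D : ℕ) (v : ℕ → V) (T : Finset V) (a b : ℕ) : Finset V :=
  T \ (segment v 0 a ∪ segment v (D + 1 - b) (D + 1))

/-- The pairs `(a, b)` such that `T` starts with `v 0, …, v a`, ends with `v (D - b), …, v D`
and stays connected when the first `a` and the last `b` vertices are removed. -/
noncomputable def trimPairs (G : SimpleGraph V) (D : ℕ) (v : ℕ → V) (T : Finset V) :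
    Finset (ℕ × ℕ) :=
  (Finset.range (D + 1) ×ˢ Finset.range (D + 1)).filter fun x =>
    x.1 + x.2 ≤ D ∧ segment v 0 (x.1 + 1) ⊆ T ∧ segment v (D - x.2) (D + 1) ⊆ T ∧
      G.IsConnectedSet (trim D v T x.1 x.2)

lemma mem_trimPairs {T : Finset V} {a b : ℕ} :
    (a, b) ∈ trimPairs G D v T ↔ a + b ≤ D ∧ segment v 0 (a + 1) ⊆ T ∧
      segment v (D - b) (D + 1) ⊆ T ∧ G.IsConnectedSet (trim D v T a b) := by
  simp only [trimPairs, Finset.mem_filter, Finset.mem_product, Finset.mem_range]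
  constructor
  · exact fun h => h.2
  · exact fun h => ⟨by omega, h⟩

lemma segment_mono {i j i' j' : ℕ} (hi : i' ≤ i) (hj : j ≤ j') :
    segment v i j ⊆ segment v i' j' := fun x hx => by
  obtain ⟨k, h1, h2, h3⟩ := mem_segment.mp hx
  exact mem_segment.mpr ⟨k, by omega, by omega, h3⟩

lemma trim_zero_zero (T : Finset V) : trim D v T 0 0 = T := by
  simp [trim, segment]

lemma trim_subset (T : Finset V) (a b : ℕ) : trim D v T a b ⊆ T := Finset.sdiff_subset

lemma trim_union {T : Finset V} {a b : ℕ} (ha : segment v 0 (a + 1) ⊆ T)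
    (hb : segment v (D - b) (D + 1) ⊆ T) :
    trim D v T a b ∪ (segment v 0 a ∪ segment v (D + 1 - b) (D + 1)) = T := by
  refine Finset.sdiff_union_of_subset (Finset.union_subset ?_ ?_)
  · exact (segment_mono le_rfl (by omega)).trans ha
  · exact (segment_mono (by omega) le_rfl).trans hb

namespace IsDiametralSeq

lemma mem_trim (h : IsDiametralSeq G D v) {T : Finset V} {a b k : ℕ} (hk : k ≤ D)
    (hab : a + b ≤ D) : v k ∈ trim D v T a b ↔ v k ∈ T ∧ a ≤ k ∧ k ≤ D - b := by
  rw [trim, Finset.mem_sdiff, Finset.mem_union, h.mem_segment_iff hk (by omega),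
    h.mem_segment_iff hk (by omega)]
  refine and_congr_right fun _ => ?_
  omega

/-- Undoing one trim restores `v a`, which is adjacent to the still present `v (a + 1)`. Together
with its mirror image this makes `trimPairs` a lower set. -/
lemma mem_trimPairs_of_succ_left (h : IsDiametralSeq G D v) {T : Finset V} {a b : ℕ}
    (hab : (a + 1, b) ∈ trimPairs G D v T) : (a, b) ∈ trimPairs G D v T := by
  rw [mem_trimPairs] at hab ⊢
  obtain ⟨h1, h2, h3, h4⟩ := hab
  refine ⟨by omega, (segment_mono le_rfl (by omega)).trans h2, h3, ?_⟩
  have hT : ∀ k ≤ a + 1, v k ∈ T := fun k hk => h2 (mem_segment.mpr ⟨k, by omega, by omega, rfl⟩)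
  have : trim D v T a b = insert (v a) (trim D v T (a + 1) b) := by
    ext x
    rw [Finset.mem_insert]
    by_cases hx : x = v a
    · subst hx
      simp [h.mem_trim (T := T) (k := a) (show a ≤ D by omega) (show a + b ≤ D by omega),
        hT a (by omega)]
      omega
    · have : x ∈ segment v 0 (a + 1) ↔ x ∈ segment v 0 a := by
        simp only [mem_segment]
        constructor
        · rintro ⟨k, hk1, hk2, rfl⟩
          exact ⟨k, hk1, lt_of_le_of_ne (by omega) (fun hh => hx (by rw [hh])), rfl⟩
        · rintro ⟨k, hk1, hk2, rfl⟩
          exact ⟨k, hk1, by omega, rfl⟩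
      simp [trim, hx, this]
  rw [this]
  refine h4.insert_of_adj (y := v (a + 1)) ?_ (h.adj a (by omega))
  rw [h.mem_trim (by omega) h1]
  exact ⟨hT _ le_rfl, le_rfl, by omega⟩

lemma mem_trimPairs_of_succ_right (h : IsDiametralSeq G D v) {T : Finset V} {a b : ℕ}
    (hab : (a, b + 1) ∈ trimPairs G D v T) : (a, b) ∈ trimPairs G D v T := by
  rw [mem_trimPairs] at hab ⊢
  obtain ⟨h1, h2, h3, h4⟩ := hab
  refine ⟨by omega, h2, (segment_mono (by omega) le_rfl).trans h3, ?_⟩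
  have hT : ∀ k ≤ D, D - (b + 1) ≤ k → v k ∈ T := fun k hk hk' =>
    h3 (mem_segment.mpr ⟨k, by omega, by omega, rfl⟩)
  have : trim D v T a b = insert (v (D - b)) (trim D v T a (b + 1)) := by
    ext x
    rw [Finset.mem_insert]
    by_cases hx : x = v (D - b)
    · subst hx
      simp [h.mem_trim (T := T) (k := D - b) (show D - b ≤ D by omega) (show a + b ≤ D by omega),
        hT (D - b) (by omega) (by omega)]
      omega
    · have : x ∈ segment v (D + 1 - (b + 1)) (D + 1) ↔ x ∈ segment v (D + 1 - b) (D + 1) := by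
        simp only [mem_segment]
        constructor
        · rintro ⟨k, hk1, hk2, rfl⟩
          have : k ≠ D - b := fun hh => hx (by rw [hh])
          exact ⟨k, by omega, hk2, rfl⟩
        · rintro ⟨k, hk1, hk2, rfl⟩
          exact ⟨k, by omega, by omega, rfl⟩
      simp only [trim, Finset.mem_sdiff, Finset.mem_union, this, hx, false_or]
  rw [this]
  refine h4.insert_of_adj (y := v (D - (b + 1))) ?_ ?_
  · rw [h.mem_trim (by omega) h1]
    exact ⟨hT _ (by omega) le_rfl, by omega, le_rfl⟩
  · have := h.adj (D - (b + 1)) (by omega)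
    rw [show D - (b + 1) + 1 = D - b by omega] at this
    exact this.symm

lemma mem_trimPairs_of_le (h : IsDiametralSeq G D v) {T : Finset V} {a b a' b' : ℕ}
    (hab : (a, b) ∈ trimPairs G D v T) (ha : a' ≤ a) (hb : b' ≤ b) :
    (a', b') ∈ trimPairs G D v T := by
  induction a, ha using Nat.le_induction with
  | base =>
    induction b, hb using Nat.le_induction with
    | base => exact hab
    | succ b _ ih => exact ih (h.mem_trimPairs_of_succ_right hab)
  | succ a _ ih => exact ih (h.mem_trimPairs_of_succ_left hab)

/-- The trimmed set reveals `a` and `D - b` as the least and greatest indices of path vertices in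
it; adding back the removed ends then recovers `T`. -/
lemma trim_injective (h : IsDiametralSeq G D v) {T T' : Finset V} {a b a' b' : ℕ}
    (hab : (a, b) ∈ trimPairs G D v T) (hab' : (a', b') ∈ trimPairs G D v T')
    (heq : trim D v T a b = trim D v T' a' b') : T = T' ∧ a = a' ∧ b = b' := by
  rw [mem_trimPairs] at hab hab'
  obtain ⟨h1, h2, h3, h4⟩ := hab
  obtain ⟨h1', h2', h3', h4'⟩ := hab'
  have key : ∀ {T T' : Finset V} {a b a' b' : ℕ}, a + b ≤ D → a' + b' ≤ D →
      segment v 0 (a + 1) ⊆ T → segment v (D - b) (D + 1) ⊆ T →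
      trim D v T a b = trim D v T' a' b' → a' ≤ a ∧ b' ≤ b := by
    intro T T' a b a' b' h1 h1' h2 h3 heq
    have e1 : v a ∈ trim D v T a b := (h.mem_trim (by omega) h1).mpr
      ⟨h2 (mem_segment.mpr ⟨a, by omega, by omega, rfl⟩), le_rfl, by omega⟩
    have e2 : v (D - b) ∈ trim D v T a b := (h.mem_trim (by omega) h1).mpr
      ⟨h3 (mem_segment.mpr ⟨D - b, by omega, by omega, rfl⟩), by omega, le_rfl⟩
    rw [heq, h.mem_trim (by omega) h1'] at e1 e2
    omega
  have k1 := key h1 h1' h2 h3 heq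
  have k2 := key h1' h1 h2' h3' heq.symm
  obtain rfl : a = a' := by omega
  obtain rfl : b = b' := by omega
  refine ⟨?_, rfl, rfl⟩
  rw [← trim_union h2 h3, ← trim_union h2' h3', heq]

/-- Take `v a` and `v (D - b)` to be the first and last path vertices in `S`, and add the path
outside them. -/
lemma exists_trim_eq (h : IsDiametralSeq G D v) {S : Finset V} (hS : G.IsConnectedSet S)
    (hmeet : ∃ k ≤ D, v k ∈ S) :
    ∃ T a b, (a, b) ∈ trimPairs G D v T ∧ trim D v T a b = S := by
  obtain ⟨a, ⟨haD, haS⟩, hamin⟩ : ∃ a, (a ≤ D ∧ v a ∈ S) ∧ ∀ k < a, ¬ (k ≤ D ∧ v k ∈ S) :=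
    ⟨Nat.find hmeet, Nat.find_spec hmeet, fun k => Nat.find_min hmeet⟩
  have hmeet' : ∃ b, b ≤ D ∧ v (D - b) ∈ S := ⟨D - a, by omega, by
    rwa [show D - (D - a) = a by omega]⟩
  obtain ⟨b, ⟨hbD, hbS⟩, hbmin⟩ : ∃ b, (b ≤ D ∧ v (D - b) ∈ S) ∧
      ∀ k < b, ¬ (k ≤ D ∧ v (D - k) ∈ S) :=
    ⟨Nat.find hmeet', Nat.find_spec hmeet', fun k => Nat.find_min hmeet'⟩
  have hab : a + b ≤ D := by
    by_contra hlt
    exact hamin (D - b) (by omega) ⟨by omega, hbS⟩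
  have htrim : trim D v (S ∪ (segment v 0 (a + 1) ∪ segment v (D - b) (D + 1))) a b = S := by
    ext x
    constructor
    · intro hx
      have hxT := trim_subset _ _ _ hx
      simp only [Finset.mem_union] at hxT
      rcases hxT with hxS | hxs | hxs
      · exact hxS
      all_goals
        obtain ⟨k, hk1, hk2, rfl⟩ := mem_segment.mp hxs
        have := (h.mem_trim (by omega) hab).mp hx
      · obtain rfl : k = a := by omega
        exact haS
      · obtain rfl : k = D - b := by omega
        exact hbS
    · intro hx
      refine Finset.mem_sdiff.mpr ⟨Finset.mem_union_left _ hx, ?_⟩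
      simp only [Finset.mem_union, mem_segment, not_or]
      constructor
      · rintro ⟨k, hk1, hk2, rfl⟩
        exact hamin k hk2 ⟨by omega, hx⟩
      · rintro ⟨k, hk1, hk2, rfl⟩
        exact hbmin (D - k) (by omega) ⟨by omega, by rwa [show D - (D - k) = k by omega]⟩
  refine ⟨_, a, b, mem_trimPairs.mpr ⟨hab, ?_, ?_, ?_⟩, htrim⟩
  · exact Finset.subset_union_left.trans Finset.subset_union_right
  · exact Finset.subset_union_right.trans Finset.subset_union_right
  · rwa [htrim]

end IsDiametralSeq

end Trimming

end SimpleGraph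

namespace SimpleGraph

/-! ### Charging connected sets to those containing both ends -/

section Counting

open scoped Classical

variable {V : Type*} {G : SimpleGraph V} {D : ℕ} {v : ℕ → V}

namespace IsDiametralSeq

/-- A connected set `S` avoiding the diametral path is determined by its distance `c` to the path
and a connected set obtained by joining `S` to the path. -/
lemma exists_join_of_disjoint (h : IsDiametralSeq G D v) {S : Finset V}
    (hS : G.IsConnectedSet S) (hdisj : ∀ k ≤ D, v k ∉ S) :
    ∃ T : Finset V, ∃ c, G.IsConnectedSet T ∧ segment v 0 (D + 1) ⊆ T ∧ 1 ≤ c ∧ c ≤ D ∧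
      c ≤ (T \ segment v 0 (D + 1)).card ∧
      T.filter (fun x => ∀ i ≤ D, c ≤ G.dist x (v i)) = S := by
  -- A closest pair gives `c = dist x (v i)`. All of `S` is at distance at least `c` from the path,
  -- while every vertex added in the join, except `x` itself, is closer.
  obtain ⟨⟨x, i⟩, hxi, hmin⟩ := Finset.exists_min_image (S ×ˢ Finset.range (D + 1))
    (fun y => G.dist y.1 (v y.2)) (hS.nonempty.product ⟨0, by simp⟩)
  simp only [Finset.mem_product, Finset.mem_range] at hxi hmin
  obtain ⟨hxS, hi⟩ := hxi
  have hmin' : ∀ y ∈ S, ∀ j ≤ D, G.dist x (v i) ≤ G.dist y (v j) := fun y hy j hj =>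
    hmin (y, j) ⟨hy, by omega⟩
  obtain ⟨p, hp, hpl⟩ := h.connected.exists_path_of_dist x (v i)
  have hcpos : 1 ≤ G.dist x (v i) := by
    refine h.connected.pos_dist_of_ne ?_
    rintro rfl
    exact hdisj i (by omega) hxS
  have hpconn : G.IsConnectedSet p.support.toFinset := by
    have := p.connected_induce_support
    unfold IsConnectedSet
    convert this <;> simp
  have hTconn : G.IsConnectedSet (S ∪ p.support.toFinset ∪ segment v 0 (D + 1)) := by
    refine (hS.union hpconn ⟨x, hxS, by simp⟩).union
      (h.isConnectedSet_segment (by omega) le_rfl) ⟨v i, by simp, ?_⟩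
    exact mem_segment.mpr ⟨i, by omega, by omega, rfl⟩
  refine ⟨_, G.dist x (v i), hTconn, Finset.subset_union_right, hcpos, h.dist_le _ _, ?_, ?_⟩
  -- The first `c` vertices of the joining path are distinct and, by minimality of `c`, off the
  -- diametral path.
  · have hsub : (Finset.range (G.dist x (v i))).image p.getVert ⊆
        (S ∪ p.support.toFinset ∪ segment v 0 (D + 1)) \ segment v 0 (D + 1) := by
      intro y hy
      obtain ⟨k, hk, rfl⟩ := Finset.mem_image.mp hy
      rw [Finset.mem_range] at hk
      refine Finset.mem_sdiff.mpr ⟨?_, ?_⟩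
      · simp [p.getVert_mem_support k]
      · intro hy
        obtain ⟨j, -, hj, hjk⟩ := mem_segment.mp hy
        have h1 := SimpleGraph.dist_le (p.take k)
        rw [Walk.take_length, ← hjk] at h1
        have h2 := hmin' x hxS j (by omega)
        omega
    have hcard := Finset.card_le_card hsub
    rwa [Finset.card_image_of_injOn, Finset.card_range] at hcard
    refine hp.getVert_injOn.mono fun k hk => ?_
    simp only [Finset.coe_range, Set.mem_Iio] at hk
    show k ≤ p.length
    omega
  · ext y
    simp only [Finset.mem_filter, Finset.mem_union, List.mem_toFinset]
    constructor
    · rintro ⟨(hy | hy) | hy, hd⟩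
      · exact hy
      · obtain ⟨k, rfl, hk⟩ := Walk.mem_support_iff_exists_getVert.mp hy
        have h1 := SimpleGraph.dist_le (p.drop k)
        rw [Walk.drop_length] at h1
        have h2 := hd i (by omega)
        obtain rfl : k = 0 := by omega
        rwa [p.getVert_zero]
      · obtain ⟨j, -, hj, rfl⟩ := mem_segment.mp hy
        have := hd j (by omega)
        rw [SimpleGraph.dist_self] at this
        omega
    · exact fun hy => ⟨Or.inl (Or.inl hy), fun j hj => hmin' y hy j hj⟩

lemma zero_mem_trimPairs_iff {T : Finset V} : (0, 0) ∈ trimPairs G D v T ↔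
    G.IsConnectedSet T ∧ v 0 ∈ T ∧ v D ∈ T := by
  rw [mem_trimPairs, trim_zero_zero]
  simp [segment]
  tauto

variable [Fintype V]

/-- The connected sets containing both ends of the diametral path. -/
noncomputable def spanningSets (G : SimpleGraph V) (D : ℕ) (v : ℕ → V) : Finset (Finset V) :=
  Finset.univ.filter fun T => G.IsConnectedSet T ∧ v 0 ∈ T ∧ v D ∈ T

lemma mem_spanningSets {T : Finset V} : T ∈ spanningSets G D v ↔
    G.IsConnectedSet T ∧ v 0 ∈ T ∧ v D ∈ T := by
  simp [spanningSets]

lemma mem_connectedSets {S : Finset V} : S ∈ G.connectedSets ↔ G.IsConnectedSet S := by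
  simp [connectedSets]

/-- Trimming is injective on pairs of `T` and `(a, b)`. It is applied with `a = 0` for sets
containing `v 0` and with `b = 0` for those containing `v D`. -/
lemma sum_card_filter_le (h : IsDiametralSeq G D v) (p : ℕ × ℕ → Prop) (q : Finset V → Prop)
    [DecidablePred p] [DecidablePred q]
    (hpq : ∀ T a b, (a, b) ∈ trimPairs G D v T → p (a, b) → q (trim D v T a b)) :
    ∑ T ∈ spanningSets G D v, ((trimPairs G D v T).filter p).card ≤
      (G.connectedSets.filter q).card := by
  rw [← Finset.card_sigma]
  refine Finset.card_le_card_of_injOn (fun x => trim D v x.1 x.2.1 x.2.2) ?_ ?_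
  · rintro ⟨T, a, b⟩ hx
    simp only [Finset.mem_coe, Finset.mem_sigma, Finset.mem_filter] at hx
    obtain ⟨-, h1, h2⟩ := hx
    simp only [Finset.mem_coe, Finset.mem_filter, mem_connectedSets]
    exact ⟨(mem_trimPairs.mp h1).2.2.2, hpq _ _ _ h1 h2⟩
  · rintro ⟨T, a, b⟩ hx ⟨T', a', b'⟩ hx' heq
    simp only [Finset.mem_coe, Finset.mem_sigma, Finset.mem_filter] at hx hx'
    obtain ⟨rfl, rfl, rfl⟩ := h.trim_injective hx.2.1 hx'.2.1 heq
    rfl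

lemma sum_le_numConnectedSetsAt_start (h : IsDiametralSeq G D v) :
    ∑ T ∈ spanningSets G D v, ((trimPairs G D v T).filter fun x => x.1 = 0).card ≤
      G.numConnectedSetsAt (v 0) := by
  unfold numConnectedSetsAt
  refine h.sum_card_filter_le (fun x => x.1 = 0) (fun S => v 0 ∈ S) ?_
  rintro T a b hab rfl
  obtain ⟨h1, h2, -, -⟩ := mem_trimPairs.mp hab
  exact (h.mem_trim (by omega) h1).mpr
    ⟨h2 (mem_segment.mpr ⟨0, by omega, by omega, rfl⟩), le_rfl, by omega⟩

lemma sum_le_numConnectedSetsAt_end (h : IsDiametralSeq G D v) :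
    ∑ T ∈ spanningSets G D v, ((trimPairs G D v T).filter fun x => x.2 = 0).card ≤
      G.numConnectedSetsAt (v D) := by
  unfold numConnectedSetsAt
  refine h.sum_card_filter_le (fun x => x.2 = 0) (fun S => v D ∈ S) ?_
  rintro T a b hab rfl
  obtain ⟨h1, -, h2, -⟩ := mem_trimPairs.mp hab
  exact (h.mem_trim (by omega) h1).mpr
    ⟨h2 (mem_segment.mpr ⟨D, by omega, by omega, rfl⟩), by omega, by omega⟩

lemma card_meeting_le (h : IsDiametralSeq G D v) :
    (G.connectedSets.filter fun S => ∃ k ≤ D, v k ∈ S).card ≤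
      ∑ T ∈ spanningSets G D v, (trimPairs G D v T).card := by
  rw [← Finset.card_sigma]
  refine Finset.card_le_card_of_surjOn (fun x => trim D v x.1 x.2.1 x.2.2) ?_
  intro S hS
  simp only [Finset.mem_coe, Finset.mem_filter, mem_connectedSets] at hS
  obtain ⟨T, a, b, hab, rfl⟩ := h.exists_trim_eq hS.1 hS.2
  refine ⟨⟨T, a, b⟩, ?_, rfl⟩
  simp only [Finset.mem_coe, Finset.mem_sigma]
  refine ⟨?_, hab⟩
  rw [mem_spanningSets, ← zero_mem_trimPairs_iff]
  exact h.mem_trimPairs_of_le hab (Nat.zero_le _) (Nat.zero_le _)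

lemma card_avoiding_le (h : IsDiametralSeq G D v) :
    (G.connectedSets.filter fun S => ¬ ∃ k ≤ D, v k ∈ S).card ≤
      ∑ T ∈ spanningSets G D v, if segment v 0 (D + 1) ⊆ T then
        min D (T \ segment v 0 (D + 1)).card else 0 := by
  have hcard : ∀ T : Finset V, (if segment v 0 (D + 1) ⊆ T then
      min D (T \ segment v 0 (D + 1)).card else 0) =
      (if segment v 0 (D + 1) ⊆ T then
        Finset.Icc 1 (min D (T \ segment v 0 (D + 1)).card) else ∅).card := by
    intro T
    split_ifs <;> simp
  rw [Finset.sum_congr rfl fun T _ => hcard T, ← Finset.card_sigma]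
  refine Finset.card_le_card_of_surjOn
    (fun x => x.1.filter fun y => ∀ i ≤ D, x.2 ≤ G.dist y (v i)) ?_
  intro S hS
  simp only [Finset.mem_coe, Finset.mem_filter, mem_connectedSets, not_exists, not_and] at hS
  obtain ⟨T, c, h1, h2, h3, h4, h5, h6⟩ := h.exists_join_of_disjoint hS.1 hS.2
  refine ⟨⟨T, c⟩, ?_, h6⟩
  simp only [Finset.mem_coe, Finset.mem_sigma, mem_spanningSets]
  refine ⟨⟨h1, h2 (mem_segment.mpr ⟨0, by omega, by omega, rfl⟩),
    h2 (mem_segment.mpr ⟨D, by omega, by omega, rfl⟩)⟩, ?_⟩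
  rw [if_pos h2, Finset.mem_Icc]
  omega

end IsDiametralSeq

end Counting

end SimpleGraph

namespace SimpleGraph

/-! ### The inequality for each set containing both ends -/

section Estimates

open scoped Classical

/-- The pairs of natural numbers with sum at most `D`. -/
def triangle (D : ℕ) : Finset (ℕ × ℕ) := (Finset.range (D + 1)).biUnion Finset.HasAntidiagonal.antidiagonal

lemma mem_triangle {D a b : ℕ} : (a, b) ∈ triangle D ↔ a + b ≤ D := by
  simp [triangle]

lemma two_mul_card_triangle (D : ℕ) : 2 * (triangle D).card = (D + 1) * (D + 2) := by
  rw [triangle, Finset.card_biUnion]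
  · simp only [Finset.Nat.card_antidiagonal]
    induction D with
    | zero => rfl
    | succ n ih => rw [Finset.sum_range_succ, mul_add, ih]; ring
  · intro i _ j _ hij
    rw [Function.onFun, Finset.disjoint_left]
    intro x hx hx'
    rw [Finset.HasAntidiagonal.mem_antidiagonal] at hx hx'
    exact hij (hx.symm.trans hx')

/-- With `s = a + b`, AM-GM bounds `4 (a + 1) (b + 1)` by `(s + 2) ^ 2`. For `s ≤ D` the remaining
claim is `4 E ≤ (s + 2) (D - s + m)`. For `s > D` the saving `s - D` in `hR'` is used, and `k < m`
keeps `m - (s - D)` nonnegative. -/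
lemma four_mul_le_of_proper {D m a b k R E : ℕ} (hD : 1 ≤ D) (hk : k + 1 ≤ m) (hED : E ≤ D)
    (hEk : E ≤ k) (hab : a + b ≤ D + 1 + k) (hR : R ≤ (a + 1) * (b + 1))
    (hR' : R + (a + b) ≤ (a + 1) * (b + 1) + D) :
    4 * (R + E) ≤ (D + 2 + m) * ((b + 1) + (a + 1)) := by
  zify at *
  have hsq : 4 * (((a : ℤ) + 1) * (b + 1)) ≤ (a + b + 2) ^ 2 := by
    nlinarith [sq_nonneg ((a : ℤ) - b)]
  by_cases hs : (a : ℤ) + b ≤ D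
  · have key : 4 * (E : ℤ) ≤ (a + b + 2) * (D - (a + b) + m) := by
      obtain h0 | h1 | h2 : a + b = 0 ∨ a + b = 1 ∨ 2 ≤ a + b := by omega
      · zify at h0; rw [h0]; linarith
      · zify at h1; rw [h1]; linarith
      · zify at h2; nlinarith
    nlinarith
  · have key : (4 : ℤ) * (m - (a + b - D)) ≤ (a + b + 2) * (m - (a + b - D)) :=
      mul_le_mul_of_nonneg_right (by linarith) (by linarith)
    nlinarith

lemma four_mul_lt_of_full {D m a b R E : ℕ} (hD : 1 ≤ D) (hm : 1 ≤ m)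
    (hEm : E ≤ m) (hab : a + b ≤ D + 1 + m) (hR : R ≤ (a + 1) * (b + 1))
    (hR' : R + (a + b) ≤ (a + 1) * (b + 1) + D) :
    4 * (R + E) < (D + 2 + m) * ((b + 1) + (a + 1)) + 2 * (D + 1) * m := by
  zify at *
  have hsq : 4 * (((a : ℤ) + 1) * (b + 1)) ≤ (a + b + 2) ^ 2 := by
    nlinarith [sq_nonneg ((a : ℤ) - b)]
  have hDm : (m : ℤ) ≤ D * m := le_mul_of_one_le_left (by linarith) hD
  by_cases hs : (a : ℤ) + b ≤ D
  · have key : (2 : ℤ) * (D - (a + b) + m) ≤ (a + b + 2) * (D - (a + b) + m) :=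
      mul_le_mul_of_nonneg_right (by linarith) (by linarith)
    nlinarith
  · by_cases hr : (a : ℤ) + b ≤ D + m
    · have key : (4 : ℤ) * (m - (a + b - D)) ≤ (a + b + 2) * (m - (a + b - D)) :=
        mul_le_mul_of_nonneg_right (by linarith) (by linarith)
      nlinarith
    -- The only case where `m - (a + b - D)` is negative: it equals `-1`, and the extra term `2 (D +
    -- 1) m` pays for it.
    · have hs' : (a : ℤ) + b = D + m + 1 := by linarith
      have : (D : ℤ) ≤ D * m := le_mul_of_one_le_right (by linarith) hm
      nlinarith

variable {V : Type*} {G : SimpleGraph V} {D : ℕ} {v : ℕ → V}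

namespace IsDiametralSeq

lemma segment_subset_of_lt {T : Finset V} {a b : ℕ}
    (ha : (a, 0) ∈ trimPairs G D v T) (hb : (0, b) ∈ trimPairs G D v T) (hab : D < a + b) :
    segment v 0 (D + 1) ⊆ T := by
  obtain ⟨-, ha, -, -⟩ := mem_trimPairs.mp ha
  obtain ⟨-, -, hb, -⟩ := mem_trimPairs.mp hb
  intro x hx
  obtain ⟨k, -, hk, rfl⟩ := mem_segment.mp hx
  by_cases hka : k ≤ a
  · exact ha (mem_segment.mpr ⟨k, by omega, by omega, rfl⟩)
  · exact hb (mem_segment.mpr ⟨k, by omega, by omega, rfl⟩)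

/-- Each level `t` strictly between `D - b` and `a` contains a vertex of `T` off the path. Take `z`
in `T` off the path. If `z` lies at level at most `t`, connect it to `v D` in `T` without its first
`a` path vertices; otherwise connect `v 0` to `z` without the last `b`. Either way level `t` is
crossed where its path vertex has been removed. -/
lemma add_le_of_segment_ssubset (h : IsDiametralSeq G D v) {T : Finset V} {a b : ℕ}
    (ha : (a, 0) ∈ trimPairs G D v T) (hb : (0, b) ∈ trimPairs G D v T)
    (hT : segment v 0 (D + 1) ⊂ T) :
    a + b ≤ D + 1 + (T \ segment v 0 (D + 1)).card := by
  obtain ⟨z, hzT, hzP⟩ := Finset.exists_of_ssubset hT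
  obtain ⟨haD, -, hDT, ha⟩ := mem_trimPairs.mp ha
  obtain ⟨hbD, h0T, -, hb⟩ := mem_trimPairs.mp hb
  have hz : ∀ a b, z ∈ trim D v T a b ∨ D < a + b := by
    intro a b
    by_cases hlt : D < a + b
    · exact Or.inr hlt
    refine Or.inl (Finset.mem_sdiff.mpr ⟨hzT, fun hz => hzP ?_⟩)
    rcases Finset.mem_union.mp hz with hz | hz
    · exact segment_mono le_rfl (by omega) hz
    · exact segment_mono (by omega) le_rfl hz
  have hza := (hz a 0).resolve_right (by omega)
  have hzb := (hz 0 b).resolve_right (by omega)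
  have hDa : v D ∈ trim D v T a 0 := (h.mem_trim le_rfl haD).mpr
    ⟨hDT (mem_segment.mpr ⟨D, by omega, by omega, rfl⟩), by omega, by omega⟩
  have h0b : v 0 ∈ trim D v T 0 b := (h.mem_trim (by omega) hbD).mpr
    ⟨h0T (mem_segment.mpr ⟨0, by omega, by omega, rfl⟩), by omega, by omega⟩
  have hsub : Finset.Ioo (D - b) a ⊆ (T \ segment v 0 (D + 1)).image (G.dist (v 0)) := by
    intro t ht
    rw [Finset.mem_Ioo] at ht
    by_contra hcon
    have hmiss : ∀ y ∈ T, y ∉ segment v 0 (D + 1) → G.dist (v 0) y ≠ t := fun y hy hyP hyt =>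
      hcon (Finset.mem_image.mpr ⟨y, Finset.mem_sdiff.mpr ⟨hy, hyP⟩, hyt⟩)
    have hgt : t < G.dist (v 0) z := by
      by_contra hle
      obtain ⟨y, hy, hyt⟩ := ha.exists_eq h.dist_le_dist_add_one hza hDa (t := t) (by omega)
        (by rw [h.dist_eq D le_rfl]; omega)
      by_cases hyP : y ∈ segment v 0 (D + 1)
      · obtain ⟨k, -, hk, rfl⟩ := mem_segment.mp hyP
        rw [h.mem_trim (by omega) haD] at hy
        rw [h.dist_eq k (by omega)] at hyt
        omega
      · exact hmiss y (trim_subset _ _ _ hy) hyP hyt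
    obtain ⟨y, hy, hyt⟩ := hb.exists_eq h.dist_le_dist_add_one h0b hzb (t := t)
      (by simp) hgt.le
    by_cases hyP : y ∈ segment v 0 (D + 1)
    · obtain ⟨k, -, hk, rfl⟩ := mem_segment.mp hyP
      rw [h.mem_trim (by omega) hbD] at hy
      rw [h.dist_eq k (by omega)] at hyt
      omega
    · exact hmiss y (trim_subset _ _ _ hy) hyP hyt
  have hcard := (Finset.card_le_card hsub).trans Finset.card_image_le
  rw [Nat.card_Ioo] at hcard
  omega

lemma trim_segment (h : IsDiametralSeq G D v) {a b : ℕ} (hab : a + b ≤ D) :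
    trim D v (segment v 0 (D + 1)) a b = segment v a (D + 1 - b) := by
  ext x
  constructor
  · intro hx
    obtain ⟨k, -, hk, rfl⟩ := mem_segment.mp (trim_subset _ _ _ hx)
    rw [h.mem_trim (by omega) hab] at hx
    exact mem_segment.mpr ⟨k, by omega, by omega, rfl⟩
  · intro hx
    obtain ⟨k, hk1, hk2, rfl⟩ := mem_segment.mp hx
    exact (h.mem_trim (by omega) hab).mpr
      ⟨mem_segment.mpr ⟨k, by omega, by omega, rfl⟩, by omega, by omega⟩

lemma trimPairs_segment (h : IsDiametralSeq G D v) :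
    trimPairs G D v (segment v 0 (D + 1)) = triangle D := by
  ext ⟨a, b⟩
  rw [mem_trimPairs, mem_triangle]
  refine ⟨fun hab => hab.1, fun hab => ⟨hab, segment_mono le_rfl (by omega),
    segment_mono (by omega) le_rfl, ?_⟩⟩
  rw [h.trim_segment hab]
  exact h.isConnectedSet_segment (by omega) (by omega)

lemma card_fst_eq_zero_triangle (D : ℕ) : ((triangle D).filter fun x => x.1 = 0).card = D + 1 := by
  have : ((triangle D).filter fun x => x.1 = 0) = (Finset.range (D + 1)).image fun i => (0, i) := by
    ext ⟨i, j⟩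
    simp only [Finset.mem_filter, mem_triangle, Finset.mem_image, Finset.mem_range, Prod.mk.injEq]
    constructor
    · rintro ⟨h, rfl⟩
      exact ⟨j, by omega, rfl, rfl⟩
    · rintro ⟨k, hk, rfl, rfl⟩
      exact ⟨by omega, rfl⟩
  rw [this, Finset.card_image_of_injective _ (fun i j h => (Prod.mk.inj h).2), Finset.card_range]

lemma card_snd_eq_zero_triangle (D : ℕ) : ((triangle D).filter fun x => x.2 = 0).card = D + 1 := by
  have : ((triangle D).filter fun x => x.2 = 0) = (Finset.range (D + 1)).image fun i => (i, 0) := by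
    ext ⟨i, j⟩
    simp only [Finset.mem_filter, mem_triangle, Finset.mem_image, Finset.mem_range, Prod.mk.injEq]
    constructor
    · rintro ⟨h, rfl⟩
      exact ⟨i, by omega, rfl, rfl⟩
    · rintro ⟨k, hk, rfl, rfl⟩
      exact ⟨by omega, rfl⟩
  rw [this, Finset.card_image_of_injective _ (fun i j h => (Prod.mk.inj h).1), Finset.card_range]

variable [Fintype V]

/-- The contribution of one set `T` containing both ends of the path: the whole vertex set may
fall short by less than what the path itself gains. -/
lemma four_mul_add_le (h : IsDiametralSeq G D v) {m : ℕ} (hD : 1 ≤ D) (hm : 1 ≤ m)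
    (hcard : Fintype.card V = D + 1 + m) {T : Finset V} (hT : T ∈ spanningSets G D v) :
    4 * ((trimPairs G D v T).card + (if segment v 0 (D + 1) ⊆ T then
        min D (T \ segment v 0 (D + 1)).card else 0)) +
      (if T = segment v 0 (D + 1) then 2 * (D + 1) * m else 0) ≤
    (D + 2 + m) * (((trimPairs G D v T).filter fun x => x.1 = 0).card +
        ((trimPairs G D v T).filter fun x => x.2 = 0).card) +
      (if T = Finset.univ then 2 * (D + 1) * m - 1 else 0) := by
  by_cases hTP : T = segment v 0 (D + 1)
  · subst hTP
    rw [h.trimPairs_segment, card_fst_eq_zero_triangle, card_snd_eq_zero_triangle]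
    simp only [subset_rfl, if_true, Finset.sdiff_self, Finset.card_empty, Nat.min_zero, add_zero]
    -- For `T = P` the inequality is an equality: the surplus is exactly `2 (D + 1) m`.
    have := two_mul_card_triangle D
    refine le_trans (le_of_eq ?_) (Nat.le_add_right _ _)
    linear_combination 2 * this
  rw [if_neg hTP, add_zero]
  rw [mem_spanningSets, ← zero_mem_trimPairs_iff] at hT
  obtain ⟨a, b, ha, hb, hq, hp, hR, hR'⟩ := lowerSet_bounds
    (fun _ _ _ _ => h.mem_trimPairs_of_le) (fun _ _ hab => (mem_trimPairs.mp hab).1) hT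
  rw [hp, hq]
  by_cases hsub : segment v 0 (D + 1) ⊆ T
  · have hss : segment v 0 (D + 1) ⊂ T :=
      Finset.ssubset_iff_subset_ne.mpr ⟨hsub, fun e => hTP e.symm⟩
    have hab := h.add_le_of_segment_ssubset ha hb hss
    have hk := Finset.card_sdiff_of_subset hsub
    rw [h.card_segment] at hk
    rw [if_pos hsub]
    by_cases hV : T = Finset.univ
    · rw [if_pos hV]
      have hTc : T.card = Fintype.card V := by rw [hV, Finset.card_univ]
      have hkm : (T \ segment v 0 (D + 1)).card = m := by omega
      rw [hkm] at hab ⊢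
      have := four_mul_lt_of_full hD hm (min_le_right D m) hab hR hR'
      omega
    · rw [if_neg hV, add_zero]
      have hTc : T.card < Fintype.card V := Finset.card_lt_univ_of_notMem
        (Finset.exists_of_ssubset (Finset.ssubset_univ_iff.mpr hV)).choose_spec.2
      have hPT := Finset.card_lt_card hss
      rw [h.card_segment] at hPT
      exact four_mul_le_of_proper hD (by omega) (min_le_left _ _) (min_le_right _ _) hab hR hR'
  · rw [if_neg hsub, add_zero]
    have hab : a + b ≤ D := by
      by_contra hlt
      exact hsub (segment_subset_of_lt ha hb (by omega))
    refine le_trans ?_ (Nat.le_add_right _ _)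
    -- No avoiding set is charged to a `T` that misses a path vertex, hence `E = 0`; `k = 0`
    -- suffices because `a + b ≤ D`.
    simpa using four_mul_le_of_proper (E := 0) (k := 0) hD (by omega) (by omega) le_rfl
      (by omega) hR hR'

/-- If the diametral path does not cover `G`, its ends lie on average in more than the fraction
`2 / (n + 1)` of the connected sets. -/
lemma four_mul_numConnectedSets_lt (h : IsDiametralSeq G D v) {m : ℕ} (hD : 1 ≤ D) (hm : 1 ≤ m)
    (hcard : Fintype.card V = D + 1 + m) :
    4 * G.numConnectedSets <
      (D + 2 + m) * (G.numConnectedSetsAt (v 0) + G.numConnectedSetsAt (v D)) := by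
  have hN : G.numConnectedSets = (G.connectedSets.filter fun S => ∃ k ≤ D, v k ∈ S).card +
      (G.connectedSets.filter fun S => ¬ ∃ k ≤ D, v k ∈ S).card :=
    (Finset.card_filter_add_card_filter_not _).symm
  have h1 := h.card_meeting_le
  have h2 := h.card_avoiding_le
  have h3 := h.sum_le_numConnectedSetsAt_start
  have h4 := h.sum_le_numConnectedSetsAt_end
  have hsum := Finset.sum_le_sum fun T (hT : T ∈ spanningSets G D v) =>
    h.four_mul_add_le hD hm hcard hT
  simp only [Finset.sum_add_distrib, ← Finset.mul_sum, Finset.sum_ite_eq'] at hsum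
  have hP : segment v 0 (D + 1) ∈ spanningSets G D v := mem_spanningSets.mpr
    ⟨h.isConnectedSet_segment (by omega) le_rfl, mem_segment.mpr ⟨0, by omega, by omega, rfl⟩,
      mem_segment.mpr ⟨D, by omega, by omega, rfl⟩⟩
  have hU : (Finset.univ : Finset V) ∈ spanningSets G D v := by
    refine mem_spanningSets.mpr ⟨?_, Finset.mem_univ _, Finset.mem_univ _⟩
    unfold IsConnectedSet
    rw [Finset.coe_univ]
    exact (induceUnivIso G).connected_iff.mpr h.connected
  rw [if_pos hP, if_pos hU] at hsum
  have hpos : 1 ≤ 2 * (D + 1) * m := Nat.mul_pos (by omega) hm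
  have hmono := Nat.mul_le_mul_left (D + 2 + m) (Nat.add_le_add h3 h4)
  rw [hN]
  omega

end IsDiametralSeq

end Estimates

end SimpleGraph

namespace SimpleGraph

/-! ### The equality case and the choice of the end -/

section PathGraphs

open scoped Classical

variable {V : Type*} {G : SimpleGraph V} {D : ℕ} {v : ℕ → V} [Fintype V]

lemma Walk.le_add_length {W : Type*} {H : SimpleGraph W} {f : W → ℕ}
    (hf : ∀ x y, H.Adj x y → f y ≤ f x + 1) {x y : W} (p : H.Walk x y) :
    f y ≤ f x + p.length := by
  induction p with
  | nil => simp
  | cons hab p ih =>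
    have := hf _ _ hab
    rw [Walk.length_cons]
    omega

namespace IsDiametralSeq

lemma succ_le_card (h : IsDiametralSeq G D v) : D + 1 ≤ Fintype.card V := by
  rw [← h.card_segment]
  exact Finset.card_le_univ _

lemma segment_eq_univ (h : IsDiametralSeq G D v) (hcard : Fintype.card V = D + 1) :
    segment v 0 (D + 1) = Finset.univ := by
  rw [← Finset.card_eq_iff_eq_univ, h.card_segment, hcard]

lemma exists_eq_of_card_eq (h : IsDiametralSeq G D v) (hcard : Fintype.card V = D + 1) (x : V) :
    ∃ k ≤ D, v k = x := by
  have := Finset.mem_univ x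
  rw [← h.segment_eq_univ hcard] at this
  obtain ⟨k, -, hk, rfl⟩ := mem_segment.mp this
  exact ⟨k, by omega, rfl⟩

/-- In a path graph the position changes by at most one along an edge, so the two extreme vertices
force `D ≥ n - 1`. Conversely, distances from `v 0` forbid chords of the diametral path. -/
lemma isPathGraph_iff (h : IsDiametralSeq G D v) : G.IsPathGraph ↔ Fintype.card V = D + 1 := by
  constructor
  · rintro ⟨e⟩
    have hle := h.succ_le_card
    have hf : ∀ x y, G.Adj x y → (e y).val ≤ (e x).val + 1 := by
      intro x y hxy
      have := pathGraph_adj.mp (e.map_adj_iff.mpr hxy)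
      omega
    have hlt : Fintype.card V - 1 < Fintype.card V := by omega
    obtain ⟨p, hp⟩ := h.connected.exists_walk_length_eq_dist (e.symm ⟨0, by omega⟩)
      (e.symm ⟨Fintype.card V - 1, hlt⟩)
    have h1 := p.le_add_length (f := fun x => (e x).val) hf
    have h2 := h.dist_le (e.symm ⟨0, by omega⟩) (e.symm ⟨Fintype.card V - 1, hlt⟩)
    simp only [RelIso.apply_symm_apply] at h1
    omega
  · intro hcard
    have hadj : ∀ {i j}, i ≤ D → j ≤ D → (G.Adj (v i) (v j) ↔ i + 1 = j ∨ j + 1 = i) := by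
      intro i j hi hj
      constructor
      · intro hij
        have h1 := h.dist_le_dist_add_one _ _ hij
        have h2 := h.dist_le_dist_add_one _ _ hij.symm
        rw [h.dist_eq i hi, h.dist_eq j hj] at h1 h2
        have h3 : i ≠ j := fun e => hij.ne (by rw [e])
        omega
      · rintro (rfl | rfl)
        · exact h.adj i (by omega)
        · exact (h.adj j (by omega)).symm
    have hbij : Function.Bijective fun i : Fin (Fintype.card V) => v i := by
      constructor
      · intro i j hij
        exact Fin.ext (h.inj (by omega) (by omega) hij)
      · intro x
        obtain ⟨k, hk, rfl⟩ := h.exists_eq_of_card_eq hcard x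
        exact ⟨⟨k, by omega⟩, rfl⟩
    refine ⟨RelIso.symm ⟨Equiv.ofBijective _ hbij, ?_⟩⟩
    intro i j
    rw [pathGraph_adj, Equiv.ofBijective_apply, Equiv.ofBijective_apply]
    exact hadj (by omega) (by omega)

/-- Every level from `0` to `D` is met, and each level is a single vertex. -/
lemma eq_univ_of_mem_spanningSets (h : IsDiametralSeq G D v) (hcard : Fintype.card V = D + 1)
    {T : Finset V} (hT : T ∈ spanningSets G D v) : T = Finset.univ := by
  obtain ⟨hc, h0, hD⟩ := mem_spanningSets.mp hT
  refine Finset.eq_univ_of_forall fun x => ?_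
  obtain ⟨k, hk, rfl⟩ := h.exists_eq_of_card_eq hcard x
  obtain ⟨z, hz, hzk⟩ := hc.exists_eq h.dist_le_dist_add_one h0 hD (t := k) (by simp)
    (by rwa [h.dist_eq D le_rfl])
  obtain ⟨j, hj, rfl⟩ := h.exists_eq_of_card_eq hcard z
  rw [h.dist_eq j hj] at hzk
  rwa [← hzk]

/-- The connected sets of a path are the segments. -/
lemma exists_eq_trim_univ (h : IsDiametralSeq G D v) (hcard : Fintype.card V = D + 1)
    {S : Finset V} (hS : G.IsConnectedSet S) :
    ∃ a b, a + b ≤ D ∧ trim D v Finset.univ a b = S := by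
  obtain ⟨x, hx⟩ := hS.nonempty
  obtain ⟨k, hk, rfl⟩ := h.exists_eq_of_card_eq hcard x
  obtain ⟨T, a, b, hab, hTS⟩ := h.exists_trim_eq hS ⟨k, hk, hx⟩
  have hT : T ∈ spanningSets G D v := mem_spanningSets.mpr <| zero_mem_trimPairs_iff.mp <|
    h.mem_trimPairs_of_le hab (Nat.zero_le _) (Nat.zero_le _)
  rw [h.eq_univ_of_mem_spanningSets hcard hT] at hTS
  exact ⟨a, b, (mem_trimPairs.mp hab).1, hTS⟩

lemma trimPairs_univ (h : IsDiametralSeq G D v) (hcard : Fintype.card V = D + 1) :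
    trimPairs G D v Finset.univ = triangle D := by
  rw [← h.segment_eq_univ hcard, h.trimPairs_segment]

lemma trim_univ_injOn (h : IsDiametralSeq G D v) (hcard : Fintype.card V = D + 1) :
    Set.InjOn (fun x : ℕ × ℕ => trim D v Finset.univ x.1 x.2) (triangle D) := by
  rintro ⟨a, b⟩ hab ⟨a', b'⟩ hab' heq
  rw [← h.trimPairs_univ hcard] at hab hab'
  obtain ⟨-, rfl, rfl⟩ := h.trim_injective hab hab' heq
  rfl

lemma connectedSets_eq_image (h : IsDiametralSeq G D v) (hcard : Fintype.card V = D + 1) :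
    G.connectedSets = (triangle D).image fun x => trim D v Finset.univ x.1 x.2 := by
  ext S
  rw [mem_connectedSets, Finset.mem_image]
  constructor
  · intro hS
    obtain ⟨a, b, hab, rfl⟩ := h.exists_eq_trim_univ hcard hS
    exact ⟨(a, b), mem_triangle.mpr hab, rfl⟩
  · rintro ⟨⟨a, b⟩, hab, rfl⟩
    rw [← h.trimPairs_univ hcard] at hab
    exact (mem_trimPairs.mp hab).2.2.2

lemma two_mul_numConnectedSets (h : IsDiametralSeq G D v) (hcard : Fintype.card V = D + 1) :
    2 * G.numConnectedSets = (D + 1) * (D + 2) := by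
  rw [numConnectedSets, h.connectedSets_eq_image hcard,
    Finset.card_image_of_injOn (h.trim_univ_injOn hcard), two_mul_card_triangle]

lemma numConnectedSetsAt_start (h : IsDiametralSeq G D v) (hcard : Fintype.card V = D + 1) :
    G.numConnectedSetsAt (v 0) = D + 1 := by
  rw [numConnectedSetsAt, h.connectedSets_eq_image hcard, Finset.filter_image,
    Finset.card_image_of_injOn
      ((h.trim_univ_injOn hcard).mono (Finset.coe_subset.mpr (Finset.filter_subset _ _))),
    ← card_fst_eq_zero_triangle D]
  congr 1
  refine Finset.filter_congr ?_
  rintro ⟨a, b⟩ hab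
  rw [mem_triangle] at hab
  simp [h.mem_trim (Nat.zero_le _) hab]

lemma mul_numConnectedSetsAt_start (h : IsDiametralSeq G D v) (hcard : Fintype.card V = D + 1) :
    (Fintype.card V + 1) * G.numConnectedSetsAt (v 0) = 2 * G.numConnectedSets := by
  rw [h.two_mul_numConnectedSets hcard, h.numConnectedSetsAt_start hcard, hcard]
  ring

end IsDiametralSeq

lemma Walk.IsDiametral.induce_compl_singleton_connected (hG : G.Connected) {u w : V}
    {P : G.Walk u w} (hP : P.IsDiametral) (huw : u ≠ w) :
    (G.induce ({u}ᶜ : Set V)).Connected ∧ (G.induce ({w}ᶜ : Set V)).Connected := by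
  have h := hP.isDiametralSeq hG
  have hd := hP.2.1
  constructor
  · refine hG.induce_compl_singleton_of_dist_le huw.symm fun x => ?_
    rw [SimpleGraph.dist_comm (u := w) (v := u), ← hd]
    exact h.dist_le _ _
  · refine hG.induce_compl_singleton_of_dist_le huw fun x => ?_
    rw [← hd]
    exact h.dist_le _ _

/-- One of the two ends of a diametral path is contained in at least the fraction `2 / (n + 1)` of
the connected sets, with equality only for paths. -/
lemma Walk.IsDiametral.exists_end (hG : G.Connected) (hn : 3 ≤ Fintype.card V) {u w : V}
    {P : G.Walk u w} (hP : P.IsDiametral) : ∃ v : V, (v = u ∨ v = w) ∧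
      (G.induce ({v}ᶜ : Set V)).Connected ∧
      2 * (G.numConnectedSets : ℚ) / ((Fintype.card V : ℚ) + 1) ≤ (G.numConnectedSetsAt v : ℚ) ∧
      ((G.numConnectedSetsAt v : ℚ) = 2 * (G.numConnectedSets : ℚ) / ((Fintype.card V : ℚ) + 1) ↔
        G.IsPathGraph) := by
  have h := hP.isDiametralSeq hG
  have hlen : 1 ≤ P.length := by
    by_contra hlt
    have : Subsingleton V := ⟨fun x y => by
      rw [← hG.dist_eq_zero_iff]
      have := h.dist_le x y
      omega⟩
    have := Fintype.card_le_one_iff_subsingleton.mpr this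
    omega
  have huw : u ≠ w := by
    rintro rfl
    have := hP.2.1
    rw [SimpleGraph.dist_self] at this
    omega
  obtain ⟨hcu, hcw⟩ := hP.induce_compl_singleton_connected hG huw
  have hpos : (0 : ℚ) < (Fintype.card V : ℚ) + 1 := by positivity
  by_cases hpath : G.IsPathGraph
  · have heq := h.mul_numConnectedSetsAt_start (h.isPathGraph_iff.mp hpath)
    rw [P.getVert_zero] at heq
    have heq' : (G.numConnectedSetsAt u : ℚ) =
        2 * (G.numConnectedSets : ℚ) / ((Fintype.card V : ℚ) + 1) := by
      rw [eq_div_iff hpos.ne', mul_comm]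
      exact_mod_cast heq
    exact ⟨u, Or.inl rfl, hcu, heq'.ge, iff_of_true heq' hpath⟩
  · obtain ⟨m, hm⟩ := Nat.exists_eq_add_of_le h.succ_le_card
    have hm1 : 1 ≤ m := by
      have : Fintype.card V ≠ P.length + 1 := fun e => hpath (h.isPathGraph_iff.mpr e)
      omega
    have hlt := h.four_mul_numConnectedSets_lt hlen hm1 hm
    rw [P.getVert_zero, P.getVert_length, show P.length + 2 + m = Fintype.card V + 1 by omega,
      mul_add] at hlt
    -- The strict bound on the sum over both ends passes to one of them.
    obtain ⟨x, hx, hcx, hxlt⟩ : ∃ x, (x = u ∨ x = w) ∧ (G.induce ({x}ᶜ : Set V)).Connected ∧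
        2 * G.numConnectedSets < (Fintype.card V + 1) * G.numConnectedSetsAt x := by
      by_cases hu : 2 * G.numConnectedSets < (Fintype.card V + 1) * G.numConnectedSetsAt u
      · exact ⟨u, Or.inl rfl, hcu, hu⟩
      · exact ⟨w, Or.inr rfl, hcw, by omega⟩
    have hxlt' : 2 * (G.numConnectedSets : ℚ) / ((Fintype.card V : ℚ) + 1) <
        (G.numConnectedSetsAt x : ℚ) := by
      rw [div_lt_iff₀ hpos, mul_comm (G.numConnectedSetsAt x : ℚ)]
      exact_mod_cast hxlt
    exact ⟨x, hx, hcx, hxlt'.le, iff_of_false hxlt'.ne' hpath⟩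

end PathGraphs

end SimpleGraph

theorem lemma2 {V : Type*} [Fintype V] (G : SimpleGraph V) (hG : G.Connected)
    (hn : 3 ≤ Fintype.card V) :
    (∃ v : V, (∃ (w : V) (P : G.Walk v w), P.IsDiametral) ∧
      (G.induce ({v}ᶜ : Set V)).Connected ∧
      2 * (G.numConnectedSets : ℚ) / ((Fintype.card V : ℚ) + 1) ≤ (G.numConnectedSetsAt v : ℚ) ∧
      ((G.numConnectedSetsAt v : ℚ) = 2 * (G.numConnectedSets : ℚ) / ((Fintype.card V : ℚ) + 1) ↔
        G.IsPathGraph)) ∧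
    (∀ (u w : V) (P : G.Walk u w), P.IsDiametral → ∃ v : V, (v = u ∨ v = w) ∧
      (G.induce ({v}ᶜ : Set V)).Connected ∧
      2 * (G.numConnectedSets : ℚ) / ((Fintype.card V : ℚ) + 1) ≤ (G.numConnectedSetsAt v : ℚ) ∧
      ((G.numConnectedSetsAt v : ℚ) = 2 * (G.numConnectedSets : ℚ) / ((Fintype.card V : ℚ) + 1) ↔
        G.IsPathGraph)) := by
  refine ⟨?_, fun u w P hP => hP.exists_end hG hn⟩
  have := hG.nonempty
  obtain ⟨u, w, huw⟩ := G.exists_dist_eq_diam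
  obtain ⟨P, hP, hlen⟩ := hG.exists_path_of_dist u w
  have hdiam : P.IsDiametral := ⟨hP, hlen, huw⟩
  obtain ⟨x, hx, hrest⟩ := hdiam.exists_end hG hn
  refine ⟨x, ?_, hrest⟩
  rcases hx with rfl | rfl
  · exact ⟨w, P, hdiam⟩
  · exact ⟨u, P.reverse, hdiam.reverse⟩
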